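/- A group is virtually nilpotent if it has a nilpotent subgroup of finite index. For a subset $A$ of a group $G$ and an integer $h\ge 1$, let $A^h=\{a_1a_2\cdots a_h : a_i\in A\}$ be the set of products of exactly $h$ elements of $A$, let $A^{-1}=\{a^{-1}:a\in A\}$, let $\langle A\rangle$ be the subgroup generated by $A$, and for $E,F\subseteq G$ let $EF=\{ef: e\in E,\ f\in F\}$. For positive integers $r,l$, a non-empty set $A\subseteq G$ is an asymptotic $(r,l)$-approximate group if there is an integer $h_0\ge 1$ such that for every integer $h\ge h_0$ there is a set $X_h\subseteq G$ with $|X_h|\le l$ and $A^{rh}\subseteq X_hA^h$. It is an asymptotic approximate group if for every integer $r\ge 1$ there is an integer $l\ge 1$ such that $A$ is an asymptotic $(r,l)$-approximate group. Theorem (Symmetric finite sets). Let $G$ be a virtually nilpotent group and let $A\subseteq G$ be finite, non-empty and symmetric, i.e. $A^{-1}=A$. Then for every integer $r\ge 1$ there exist integers $l\ge 1$ and $h_0\ge 1$ such that, for every integer $h\ge h_0$, there is a set $X_h\subseteq\langle A\rangle$ with $$|X_h|\le l\quad\text{and}\quad A^{rh}\subseteq X_hA^h.$$ In particular, $A$ is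 an asymptotic approximate group. -/

import Mathlib

open scoped Pointwise

/-- For positive integers `r, l`, a non-empty subset `A` of a group is an asymptotic
`(r, l)`-approximate group if for all sufficiently large `h` the power `A ^ (r * h)`
(products of exactly `r * h` elements of `A`) is contained in `X * A ^ h` for some set `X`,
depending on `h`, with at most `l` elements. -/
def IsAsymptoticApproxGroupWith {G : Type*} [Group G] (r l : ℕ) (A : Set G) : Prop :=
  1 ≤ r ∧ 1 ≤ l ∧ A.Nonempty ∧
    ∃ h₀ : ℕ, 1 ≤ h₀ ∧ ∀ h : ℕ, h₀ ≤ h →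
      ∃ X : Set G, X.encard ≤ (l : ℕ∞) ∧ A ^ (r * h) ⊆ X * A ^ h

/-- A non-empty subset `A` of a group is an asymptotic approximate group if for every positive
integer `r` there is a positive integer `l` such that `A` is an asymptotic
`(r, l)`-approximate group. -/
def IsAsymptoticApproxGroup {G : Type*} [Group G] (A : Set G) : Prop :=
  A.Nonempty ∧ ∀ r : ℕ, 1 ≤ r → ∃ l : ℕ, IsAsymptoticApproxGroupWith r l A

open scoped commutatorElement

/-! Rescale at length `n`: a generator costs 1/n and an iterated commutator of weight k costs
n^(-k), so a word of length rn costs r. In a nilpotent group commutators of words of bounded cost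
have cost at most a constant times the product of the costs (`commutatorBound`), so letters can be
collected into powers, weight by weight, at bounded cost (`collect_letter`).

A collected power t^m of a weight-k letter has m = O(n^k). Divide m by n₀^k, with n₀ a small fixed
fraction of n. Boundedly many quotients occur, and the remainder power is a word of length O(n₀) up
to higher weight, because [x^a, y^b] is [x, y]^(ab) to leading order (`exists_short_letter_pow`). So
a word of length rn is an element of a set of bounded size depending on n, times a word of length at
most n/M, times an error of higher weight. Repeating this past the nilpotency class kills the error
(`thinShort_one`).

Uniformity in n and in the word is encoded by families: those of bounded cost and level k form
subgroups of `I → G` (`familySubgroup`), and constants disappear into membership. Schreier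
generators carry the covering over to virtually nilpotent groups; symmetry then gives exact word
lengths, at the price of one extra translate for parity. -/

/-- The lower central series is a strongly central series. -/
theorem Subgroup.commutator_lowerCentralSeries_le {G : Type*} [Group G] (i j : ℕ) :
    ⁅(⊤ : Subgroup G).lowerCentralSeries i, (⊤ : Subgroup G).lowerCentralSeries j⁆ ≤
      (⊤ : Subgroup G).lowerCentralSeries (i + j + 1) := by
  induction i generalizing j with
  | zero =>
    rw [Subgroup.commutator_comm, zero_add, Subgroup.lowerCentralSeries_succ,
      Subgroup.lowerCentralSeries_zero]
  | succ i ih =>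
    set N := (⊤ : Subgroup G).lowerCentralSeries (i + 1 + j + 1) with hN
    -- Modulo `N` the inclusion becomes a vanishing statement, the form in which the three subgroups
    -- lemma applies.
    have key : ∀ H : Subgroup G, H.map (QuotientGroup.mk' N) = ⊥ ↔ H ≤ N := by
      intro H
      rw [Subgroup.map_eq_bot_iff, QuotientGroup.ker_mk']
    rw [← key, Subgroup.lowerCentralSeries_succ, Subgroup.map_commutator,
      Subgroup.map_commutator]
    apply Subgroup.commutator_commutator_eq_bot_of_rotate
    · rw [← Subgroup.map_commutator, ← Subgroup.map_commutator, key,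
        Subgroup.commutator_comm ⊤, ← Subgroup.lowerCentralSeries_succ, Subgroup.commutator_comm]
      refine (ih (j + 1)).trans (le_of_eq ?_)
      rw [hN]; congr 1; omega
    · rw [← Subgroup.map_commutator, ← Subgroup.map_commutator, key, Subgroup.commutator_comm
        (Subgroup.lowerCentralSeries _ j)]
      refine (Subgroup.commutator_mono (ih j) le_rfl).trans (le_of_eq ?_)
      rw [← Subgroup.lowerCentralSeries_succ, hN]; congr 1; omega

/-! ### Weighted words and commutator estimates -/

section Letters

variable {G : Type*} [Group G]

/-- `IsLetter T m x` means that `x` is an iterated commutator of `m` elements of `T`, with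
respect to some bracketing. -/
inductive IsLetter (T : Set G) : ℕ → G → Prop
  | base {x : G} (hx : x ∈ T) : IsLetter T 1 x
  | comm {i j : ℕ} {x y : G} (hx : IsLetter T i x) (hy : IsLetter T j y) :
      IsLetter T (i + j) ⁅x, y⁆

/-- `WeightBall P ε ρ g` means that `g` is a product of elements `x` satisfying `P m x` for some
weight `m`, such that the sum of the costs `ε ^ m` is at most `ρ`. -/
inductive WeightBall (P : ℕ → G → Prop) (ε : ℝ) : ℝ → G → Prop
  | one {ρ : ℝ} (hρ : 0 ≤ ρ) : WeightBall P ε ρ 1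
  | cons {m : ℕ} {ρ σ : ℝ} {x g : G} (hx : P m x) (hg : WeightBall P ε ρ g)
      (h : ε ^ m + ρ ≤ σ) : WeightBall P ε σ (x * g)

/-- Letters of weight at least `k`. -/
def LetterGE (T : Set G) (k m : ℕ) (x : G) : Prop := k ≤ m ∧ IsLetter T m x

theorem IsLetter.pos {T : Set G} {m : ℕ} {x : G} (h : IsLetter T m x) : 1 ≤ m := by
  induction h with
  | base => exact le_rfl
  | comm _ _ h₁ h₂ => omega

theorem IsLetter.inv {T : Set G} (hT : T⁻¹ = T) {m : ℕ} {x : G} (h : IsLetter T m x) :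
    IsLetter T m x⁻¹ := by
  cases h with
  | base hx => exact .base (by rw [← hT]; simpa using hx)
  | comm hx hy =>
    rw [commutatorElement_inv, add_comm]
    exact .comm hy hx

theorem IsLetter.finite {T : Set G} (hT : T.Finite) (m : ℕ) : {x | IsLetter T m x}.Finite := by
  induction m using Nat.strong_induction_on with
  | _ m ih =>
    have h : {x | IsLetter T m x} ⊆ T ∪ ⋃ p ∈ (Finset.range m ×ˢ Finset.range m),
        Set.image2 (fun x y => ⁅x, y⁆) {x | IsLetter T p.1 x} {x | IsLetter T p.2 x} := by
      intro x hx
      cases hx with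
      | base hx => exact Or.inl hx
      | @comm i j x y hx hy =>
        refine Or.inr (Set.mem_biUnion (x := (i, j)) ?_ ⟨x, hx, y, hy, rfl⟩)
        have := hx.pos
        have := hy.pos
        simp only [Finset.coe_product, Finset.coe_range, Set.mem_prod, Set.mem_Iio]
        omega
    refine Set.Finite.subset (hT.union (Set.Finite.biUnion (Finset.finite_toSet _) ?_)) h
    rintro ⟨i, j⟩ hp
    simp only [Finset.coe_product, Finset.coe_range, Set.mem_prod, Set.mem_Iio] at hp
    exact Set.Finite.image2 _ (ih i hp.1) (ih j hp.2)

theorem IsLetter.mem_lowerCentralSeries {T : Set G} {m : ℕ} {x : G} (h : IsLetter T m x) :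
    x ∈ (⊤ : Subgroup G).lowerCentralSeries (m - 1) := by
  induction h with
  | base => simp
  | @comm i j x y hx hy h₁ h₂ =>
    have := hx.pos
    have := hy.pos
    have h := Subgroup.commutator_lowerCentralSeries_le _ _
      (Subgroup.commutator_mem_commutator h₁ h₂)
    rwa [show i - 1 + (j - 1) + 1 = i + j - 1 by omega] at h

namespace WeightBall

variable {P Q : ℕ → G → Prop} {ε ρ σ : ℝ} {g h : G}

theorem nonneg (hε : 0 ≤ ε) (hg : WeightBall P ε ρ g) : 0 ≤ ρ := by
  induction hg with
  | one hρ => exact hρ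
  | cons _ _ h ih => exact (add_nonneg (pow_nonneg hε _) ih).trans h

theorem mono_radius (hg : WeightBall P ε ρ g) (h : ρ ≤ σ) : WeightBall P ε σ g := by
  cases hg with
  | one hρ => exact .one (hρ.trans h)
  | cons hx hg h' => exact .cons hx hg (h'.trans h)

theorem mono (hg : WeightBall P ε ρ g) (h : ∀ m x, P m x → Q m x) : WeightBall Q ε ρ g := by
  induction hg with
  | one hρ => exact .one hρ
  | cons hx _ h' ih => exact .cons (h _ _ hx) ih h'

theorem mul (hg : WeightBall P ε ρ g) (hh : WeightBall P ε σ h) :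
    WeightBall P ε (ρ + σ) (g * h) := by
  induction hg with
  | one hρ => rw [one_mul]; exact hh.mono_radius (by linarith)
  | cons hx _ h' ih => rw [mul_assoc]; exact .cons hx ih (by linarith)

theorem of_letter {m : ℕ} {x : G} (hx : P m x) : WeightBall P ε (ε ^ m) x := by
  rw [← mul_one x]
  exact .cons hx (.one le_rfl) (by simp)

theorem inv (hP : ∀ m x, P m x → P m x⁻¹) (hg : WeightBall P ε ρ g) : WeightBall P ε ρ g⁻¹ := by
  induction hg with
  | one hρ => rw [inv_one]; exact .one hρ
  | cons hx _ h' ih =>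
    rw [mul_inv_rev]
    exact (ih.mul (of_letter (hP _ _ hx))).mono_radius (by linarith)

theorem pow (hg : WeightBall P ε ρ g) (n : ℕ) : WeightBall P ε (n * ρ) (g ^ n) := by
  induction n with
  | zero => simpa using WeightBall.one (P := P) (ε := ε) le_rfl
  | succ n ih => rw [pow_succ]; exact (ih.mul hg).mono_radius (by push_cast; linarith)

theorem mem_subgroup {H : Subgroup G} (hP : ∀ m x, P m x → x ∈ H) (hg : WeightBall P ε ρ g) :
    g ∈ H := by
  induction hg with
  | one => exact one_mem H
  | cons hx _ _ ih => exact mul_mem (hP _ _ hx) ih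

theorem anti {T : Set G} {j k : ℕ} (hg : WeightBall (LetterGE T k) ε ρ g) (hjk : j ≤ k) :
    WeightBall (LetterGE T j) ε ρ g :=
  hg.mono fun _ _ h => ⟨hjk.trans h.1, h.2⟩

theorem inv_letterGE {T : Set G} (hT : T⁻¹ = T) {k : ℕ}
    (hg : WeightBall (LetterGE T k) ε ρ g) : WeightBall (LetterGE T k) ε ρ g⁻¹ :=
  hg.inv fun _ _ h => ⟨h.1, h.2.inv hT⟩

theorem mem_lowerCentralSeries {T : Set G} {k : ℕ}
    (hg : WeightBall (LetterGE T k) ε ρ g) : g ∈ (⊤ : Subgroup G).lowerCentralSeries (k - 1) :=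
  hg.mem_subgroup fun _ _ h =>
    Subgroup.lowerCentralSeries_antitone ⊤ (Nat.sub_le_sub_right h.1 1)
      h.2.mem_lowerCentralSeries

end WeightBall

/-- The commutator of an element of `WeightBall (LetterGE T j) ε ρ` and an element of
`WeightBall (LetterGE T k) ε σ` lies in `WeightBall (LetterGE T (j + k)) ε (C' * (ρ * σ))`,
uniformly in `ε` and in bounded `ρ`, `σ`. -/
def CommutatorBound (T : Set G) (j k : ℕ) : Prop :=
  ∀ C : ℝ, 0 ≤ C → ∃ C' : ℝ, 0 ≤ C' ∧ ∀ ε : ℝ, 0 < ε → ε ≤ 1 → ∀ ρ σ : ℝ, ρ ≤ C → σ ≤ C →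
    ∀ x y : G, WeightBall (LetterGE T j) ε ρ x → WeightBall (LetterGE T k) ε σ y →
      WeightBall (LetterGE T (j + k)) ε (C' * (ρ * σ)) ⁅x, y⁆

/-- A commutator bound for single letters in the left variable gives one for words. -/
theorem commutator_bound_of_letters {T : Set G} {j k : ℕ} (hj : 1 ≤ j)
    (ih : CommutatorBound T j (k + 1)) {C C₁ : ℝ} (hC : 0 ≤ C) (hC₁ : 0 ≤ C₁) :
    ∃ C₂ : ℝ, 0 ≤ C₂ ∧ ∀ ε : ℝ, 0 < ε → ε ≤ 1 → ∀ σ : ℝ, 0 ≤ σ → σ ≤ C → ∀ x : G,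
      (∀ m t, LetterGE T j m t → WeightBall (LetterGE T (j + k)) ε (C₁ * (ε ^ m * σ)) ⁅t, x⁆) →
      ∀ ρ ≤ C, ∀ w, WeightBall (LetterGE T j) ε ρ w →
        WeightBall (LetterGE T (j + k)) ε (C₂ * (ρ * σ)) ⁅w, x⁆ := by
  obtain ⟨C', hC', h'⟩ := ih (C + C₁ * C) (by positivity)
  refine ⟨C' * C * C₁ + C₁, by positivity, ?_⟩
  intro ε hε hε1 σ hσ hσC x hx ρ hρ w hw
  -- The induction carries the prefix `p` already read as a conjugator. Since `τ + ρ ≤ C`, the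
  -- prefix stays bounded and the constant does not grow with the length of the word.
  suffices H : ∀ ρ w, WeightBall (LetterGE T j) ε ρ w → ∀ τ p, WeightBall (LetterGE T j) ε τ p →
      τ + ρ ≤ C → WeightBall (LetterGE T (j + k)) ε ((C' * C * C₁ + C₁) * (ρ * σ))
        (p * ⁅w, x⁆ * p⁻¹) by
    simpa using H ρ w hw 0 1 (.one le_rfl) (by simpa using hρ)
  intro ρ w hw
  induction hw with
  | one hρ => intro τ p _ _; simpa using WeightBall.one (by positivity)
  | @cons m ρ₀ ρ₁ t g ht hg h ihg =>
    intro τ p hp hτ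
    have hρ₀ := hg.nonneg hε.le
    have hτ0 := hp.nonneg hε.le
    have hm0 : 0 < ε ^ m := pow_pos hε m
    have hm1 : ε ^ m ≤ 1 := pow_le_one₀ hε.le hε1
    have h1 := ihg (τ + ε ^ m) (p * t) (hp.mul (.of_letter ht)) (by linarith)
    have h2 := hx m t ht
    have h4 : ε ^ m * σ ≤ C := by nlinarith
    have h3 := h' ε hε hε1 τ (C₁ * (ε ^ m * σ)) (by nlinarith [mul_nonneg hC₁ hC])
      (by nlinarith [mul_le_mul_of_nonneg_left h4 hC₁]) p ⁅t, x⁆ hp (h2.anti (by omega))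
    have e : p * ⁅t * g, x⁆ * p⁻¹ =
        ((p * t) * ⁅g, x⁆ * (p * t)⁻¹) * (⁅p, ⁅t, x⁆⁆ * ⁅t, x⁆) := by
      simp only [commutatorElement_def]; group
    rw [e]
    refine (h1.mul ((h3.anti (by omega)).mul h2)).mono_radius ?_
    have h5 : C' * (τ * (C₁ * (ε ^ m * σ))) ≤ C' * (C * (C₁ * (ε ^ m * σ))) := by
      have : τ ≤ C := by linarith
      gcongr
    have h6 : (C' * C * C₁ + C₁) * ((ε ^ m + ρ₀) * σ) ≤ (C' * C * C₁ + C₁) * (ρ₁ * σ) := by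
      gcongr
    nlinarith

/-- Descending induction on `j + k`: beyond the nilpotency class the commutator is trivial. Below
it, the commutator of two letters is a letter, and `commutator_bound_of_letters` extends the bound
to words in one entry, then, after inversion, in the other. -/
theorem commutatorBound {T : Set G} (hT : T⁻¹ = T) [Group.IsNilpotent G] {j k : ℕ} (hj : 1 ≤ j)
    (hk : 1 ≤ k) : CommutatorBound T j k := by
  obtain ⟨c, hc⟩ := Subgroup.nilpotent_iff_lowerCentralSeries.1 ‹Group.IsNilpotent G›
  suffices H : ∀ d j k : ℕ, 1 ≤ j → 1 ≤ k → c + 1 ≤ j + k + d → CommutatorBound T j k from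
    H (c + 1) j k hj hk (by omega)
  intro d
  induction d with
  | zero =>
    intro j k hj hk hd C _
    refine ⟨0, le_rfl, fun ε hε _ ρ σ _ _ x y hx hy => ?_⟩
    have h := Subgroup.commutator_lowerCentralSeries_le _ _
      (Subgroup.commutator_mem_commutator hx.mem_lowerCentralSeries hy.mem_lowerCentralSeries)
    have h' := Subgroup.lowerCentralSeries_antitone (⊤ : Subgroup G)
      (show c ≤ j - 1 + (k - 1) + 1 by omega) h
    rw [hc, Subgroup.mem_bot] at h'
    rw [h']
    exact .one (by simp)
  | succ d ih =>
    intro j k hj hk hd C hC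
    have ih₁ := ih j (k + 1) hj (by omega) (by omega)
    have ih₂ := ih k (j + 1) hk (by omega) (by omega)
    obtain ⟨C₂, hC₂, h₂⟩ := commutator_bound_of_letters hj ih₁ (C := C + 1) (by positivity)
      zero_le_one
    obtain ⟨C₃, hC₃, h₃⟩ := commutator_bound_of_letters hk ih₂ (C := C + 1) (by positivity) hC₂
    refine ⟨C₃, hC₃, fun ε hε hε1 ρ σ hρ hσ x y hx hy => ?_⟩
    have hxy := h₃ ε hε hε1 ρ (hx.nonneg hε.le) (by linarith) x ?_ σ (by linarith) y hy
    · rw [← commutatorElement_inv, mul_comm ρ, add_comm j]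
      exact hxy.inv_letterGE hT
    · intro m t ht
      have hm1 : ε ^ m ≤ 1 := pow_le_one₀ hε.le hε1
      have hxt := h₂ ε hε hε1 (ε ^ m) (by positivity) (by linarith) t ?_ ρ (by linarith) x hx
      · rw [← commutatorElement_inv, mul_comm (ε ^ m), add_comm k]
        exact hxt.inv_letterGE hT
      · intro m' t' ht'
        rw [one_mul, ← pow_add]
        exact .of_letter ⟨add_le_add ht'.1 ht.1, .comm ht'.2 ht.2⟩

end Letters

/-! ### Collection and commutators of powers -/

section Collection

variable {G : Type*} [Group G] {T : Set G}

theorem conj_bound (hT : T⁻¹ = T) [Group.IsNilpotent G] {j k : ℕ} (hj : 1 ≤ j) (hk : 1 ≤ k)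
    {C : ℝ} (hC : 0 ≤ C) : ∃ C' : ℝ, 0 ≤ C' ∧ ∀ ε : ℝ, 0 < ε → ε ≤ 1 → ∀ ρ σ : ℝ, ρ ≤ C →
      σ ≤ C → ∀ x y : G, WeightBall (LetterGE T j) ε ρ x → WeightBall (LetterGE T k) ε σ y →
        WeightBall (LetterGE T k) ε (C' * σ) (x * y * x⁻¹) := by
  obtain ⟨C', hC', h⟩ := commutatorBound hT hj hk C hC
  refine ⟨C' * C + 1, by positivity, fun ε hε hε1 ρ σ hρ hσ x y hx hy => ?_⟩
  have e : x * y * x⁻¹ = ⁅x, y⁆ * y := by simp [commutatorElement_def]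
  rw [e]
  refine (((h ε hε hε1 ρ σ hρ hσ x y hx hy).anti (by omega)).mul hy).mono_radius ?_
  have := hy.nonneg hε.le
  have : C' * (ρ * σ) ≤ C' * (C * σ) := by gcongr
  linarith

/-- Letters of weight at least `k`, those of weight `k` belonging to `Y`. -/
def LetterIn (T Y : Set G) (k m : ℕ) (x : G) : Prop := LetterGE T (k + 1) m x ∨ m = k ∧ x ∈ Y

/-- All occurrences of a letter `t` of minimal weight can be collected on the left. -/
theorem collect_letter (hT : T⁻¹ = T) [Group.IsNilpotent G] {k : ℕ} (hk : 1 ≤ k) {t : G}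
    (ht : IsLetter T k t) {Y : Set G} (hY : ∀ y ∈ Y, IsLetter T k y) {C : ℝ} (hC : 0 ≤ C) :
    ∃ C' : ℝ, 0 ≤ C' ∧ ∀ ε : ℝ, 0 < ε → ε ≤ 1 → ∀ ρ ≤ C, ∀ g : G,
      WeightBall (LetterIn T (insert t Y) k) ε ρ g → ∃ (m : ℕ) (g' : G), m * ε ^ k ≤ ρ ∧
        WeightBall (LetterIn T Y k) ε (C' * ρ) g' ∧ g = t ^ m * g' := by
  obtain ⟨C₁, hC₁, h₁⟩ := commutatorBound hT hk hk (C + 1) (by positivity)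
  refine ⟨1 + C₁ * C, by positivity, fun ε hε hε1 ρ hρ g hg => ?_⟩
  induction hg with
  | one h0 => exact ⟨0, 1, by simpa using h0, .one (by positivity), by simp⟩
  | @cons m ρ₀ ρ₁ x g hx hg h ih =>
    have hm0 : 0 < ε ^ m := pow_pos hε m
    have hm1 : ε ^ m ≤ 1 := pow_le_one₀ hε.le hε1
    obtain ⟨n, g', hn, hg', rfl⟩ := ih (by linarith)
    by_cases hxt : m = k ∧ x = t
    · obtain ⟨rfl, rfl⟩ := hxt
      refine ⟨n + 1, g', by push_cast; linarith, hg'.mono_radius ?_, by rw [pow_succ', mul_assoc]⟩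
      gcongr
      linarith
    · have hx' : LetterIn T Y k m x := by
        rcases hx with hx | ⟨hm, rfl | hx⟩
        · exact .inl hx
        · exact absurd ⟨hm, rfl⟩ hxt
        · exact .inr ⟨hm, hx⟩
      have hxk : LetterGE T k m x := by
        rcases hx' with hx₁ | ⟨rfl, hx₁⟩
        · exact ⟨by have := hx₁.1; omega, hx₁.2⟩
        · exact ⟨le_rfl, hY x hx₁⟩
      have hpow : WeightBall (LetterGE T k) ε (n * ε ^ k) (t ^ n) :=
        (WeightBall.of_letter (P := LetterGE T k) ⟨le_rfl, ht⟩).pow n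
      -- Here x t^n = t^n x [x⁻¹, t⁻ⁿ]. The commutator has weight at least 2k > k, so no letter of
      -- weight `k` is created, and as nε^k ≤ C its cost is at most a constant times that of `x`.
      have hc := h₁ ε hε hε1 (ε ^ m) (n * ε ^ k) (by linarith) (by linarith) x⁻¹ (t ^ n)⁻¹
        ((WeightBall.of_letter hxk).inv_letterGE hT) (hpow.inv_letterGE hT)
      have hc' : WeightBall (LetterIn T Y k) ε (C₁ * (ε ^ m * (n * ε ^ k)))
          ⁅x⁻¹, (t ^ n)⁻¹⁆ :=
        (hc.anti (show k + 1 ≤ k + k by omega)).mono fun _ _ h => .inl h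
      refine ⟨n, x * ⁅x⁻¹, (t ^ n)⁻¹⁆ * g', by linarith,
        (((WeightBall.of_letter hx').mul hc').mul hg').mono_radius ?_, ?_⟩
      · have : C₁ * (ε ^ m * (n * ε ^ k)) ≤ C₁ * (ε ^ m * C) := by
          gcongr
          linarith
        have : (1 + C₁ * C) * (ε ^ m + ρ₀) ≤ (1 + C₁ * C) * ρ₁ := by gcongr
        linarith
      · simp only [commutatorElement_def]; group

/-- With z = [x, y], each further factor x contributes z [z⁻¹, x^a]. The second factor has weight at
least 2i + j, and `conj_bound` moves it to the right past z^a. Each of the `a` steps costs O(ρσ),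
since x^a stays bounded. -/
theorem commutator_pow_left (hT : T⁻¹ = T) [Group.IsNilpotent G] {i j : ℕ} (hi : 1 ≤ i)
    (hj : 1 ≤ j) {C : ℝ} (hC : 0 ≤ C) :
    ∃ C' : ℝ, 0 ≤ C' ∧ ∀ ε : ℝ, 0 < ε → ε ≤ 1 → ∀ ρ σ : ℝ, ρ ≤ C → σ ≤ C → ∀ x y : G,
      WeightBall (LetterGE T i) ε ρ x → WeightBall (LetterGE T j) ε σ y →
      ∀ a : ℕ, a * ρ ≤ C → ∃ w, WeightBall (LetterGE T (i + j + 1)) ε (C' * (a * (ρ * σ))) w ∧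
        ⁅x ^ a, y⁆ = ⁅x, y⁆ ^ a * w := by
  obtain ⟨C₁, hC₁, h₁⟩ := commutatorBound hT hi hj C hC
  obtain ⟨C₂, hC₂, h₂⟩ := commutatorBound hT (show 1 ≤ i + j by omega) hi
    (C + C₁ * (C * C)) (by positivity)
  obtain ⟨C₃, hC₃, h₃⟩ := conj_bound hT (show 1 ≤ i + j by omega) (show 1 ≤ i + j + 1 by omega)
    (C := C₁ * (C * C) + C₂ * (C₁ * (C * C) * C)) (by positivity)
  refine ⟨C₃ * (C₂ * (C₁ * C)), by positivity, fun ε hε hε1 ρ σ hρ hσ x y hx hy a => ?_⟩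
  have hρ0 := hx.nonneg hε.le
  have hσ0 := hy.nonneg hε.le
  have hz := h₁ ε hε hε1 ρ σ hρ hσ x y hx hy
  induction a with
  | zero => intro _; exact ⟨1, .one (by simp), by simp⟩
  | succ a ih =>
    intro ha
    have ha' : a * ρ ≤ C := by push_cast at ha; linarith
    obtain ⟨w, hw, e⟩ := ih ha'
    have hzC : C₁ * (ρ * σ) ≤ C₁ * (C * C) := by gcongr
    have hza : a * (C₁ * (ρ * σ)) ≤ C₁ * (C * C) := by
      calc a * (C₁ * (ρ * σ)) = C₁ * ((a * ρ) * σ) := by ring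
        _ ≤ C₁ * (C * C) := by gcongr
    have hu := h₂ ε hε hε1 _ _ (by linarith) (by have := mul_nonneg hC₁ (mul_nonneg hC hC); linarith)
      _ _ (hz.inv_letterGE hT) (hx.pow a)
    have hu' := (hu.anti (show i + j + 1 ≤ i + j + i by omega)).mono_radius
      (show _ ≤ C₂ * (C₁ * (ρ * σ) * C) by gcongr)
    have hun : C₂ * (C₁ * (ρ * σ) * C) ≤ C₂ * (C₁ * (C * C) * C) := by gcongr
    have hv := h₃ ε hε hε1 _ _
      (hza.trans (le_add_of_nonneg_right (by positivity)))
      (hun.trans (le_add_of_nonneg_left (by positivity))) _ _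
      ((hz.pow a).inv_letterGE hT) hu'
    refine ⟨_, (hv.mul hw).mono_radius (le_of_eq ?_), ?_⟩
    · push_cast; ring
    · have e' : ⁅x ^ (a + 1), y⁆ = ⁅x, y⁆ * ⁅⁅x, y⁆⁻¹, x ^ a⁆ * ⁅x ^ a, y⁆ := by
        rw [pow_succ]; simp only [commutatorElement_def]; group
      rw [e', e, pow_succ']
      group

theorem commutator_pow_right (hT : T⁻¹ = T) [Group.IsNilpotent G] {i j : ℕ} (hi : 1 ≤ i)
    (hj : 1 ≤ j) {C : ℝ} (hC : 0 ≤ C) :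
    ∃ C' : ℝ, 0 ≤ C' ∧ ∀ ε : ℝ, 0 < ε → ε ≤ 1 → ∀ ρ σ : ℝ, ρ ≤ C → σ ≤ C → ∀ x y : G,
      WeightBall (LetterGE T i) ε ρ x → WeightBall (LetterGE T j) ε σ y →
      ∀ b : ℕ, b * σ ≤ C → ∃ w, WeightBall (LetterGE T (i + j + 1)) ε (C' * (b * (ρ * σ))) w ∧
        ⁅x, y ^ b⁆ = ⁅x, y⁆ ^ b * w := by
  obtain ⟨C₁, hC₁, h₁⟩ := commutatorBound hT hi hj C hC
  obtain ⟨C₂, hC₂, h₂⟩ := commutator_pow_left hT hj hi hC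
  obtain ⟨C₃, hC₃, h₃⟩ := conj_bound hT (show 1 ≤ i + j by omega) (show 1 ≤ i + j + 1 by omega)
    (C := C₁ * (C * C) + C₂ * (C * C)) (by positivity)
  refine ⟨C₃ * C₂, by positivity, fun ε hε hε1 ρ σ hρ hσ x y hx hy b hb => ?_⟩
  have hρ0 := hx.nonneg hε.le
  have hσ0 := hy.nonneg hε.le
  have hz := h₁ ε hε hε1 ρ σ hρ hσ x y hx hy
  obtain ⟨w, hw, e⟩ := h₂ ε hε hε1 σ ρ hσ hρ y x hy hx b hb
  have hzb : b * (C₁ * (ρ * σ)) ≤ C₁ * (C * C) := by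
    calc b * (C₁ * (ρ * σ)) = C₁ * (ρ * (b * σ)) := by ring
      _ ≤ C₁ * (C * C) := by gcongr
  have hwC : C₂ * (b * (σ * ρ)) ≤ C₂ * (C * C) := by
    rw [← mul_assoc (b : ℝ)]; gcongr
  have hw' : WeightBall (LetterGE T (i + j + 1)) ε (C₂ * (b * (σ * ρ))) w⁻¹ := by
    rw [add_comm i]; exact hw.inv_letterGE hT
  have hv := h₃ ε hε hε1 _ _
    (hzb.trans (le_add_of_nonneg_right (by positivity)))
    (hwC.trans (le_add_of_nonneg_left (by positivity))) _ _
    ((hz.pow b).inv_letterGE hT) hw'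
  refine ⟨_, hv.mono_radius (le_of_eq (by ring)), ?_⟩
  rw [← commutatorElement_inv, e, mul_inv_rev, ← inv_pow, commutatorElement_inv]
  group

theorem mul_pow_bound (hT : T⁻¹ = T) [Group.IsNilpotent G] {k : ℕ} (hk : 1 ≤ k) {C : ℝ}
    (hC : 0 ≤ C) : ∃ C' : ℝ, 0 ≤ C' ∧ ∀ ε : ℝ, 0 < ε → ε ≤ 1 → ∀ ρ τ : ℝ, τ ≤ C → ∀ z w : G,
      WeightBall (LetterGE T k) ε ρ z → WeightBall (LetterGE T (k + 1)) ε τ w →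
      ∀ a : ℕ, a * ρ ≤ C → ∃ w', WeightBall (LetterGE T (k + 1)) ε (C' * (a * τ)) w' ∧
        (z * w) ^ a = z ^ a * w' := by
  obtain ⟨C', hC', h⟩ := conj_bound hT hk (show 1 ≤ k + 1 by omega) hC
  refine ⟨C', hC', fun ε hε hε1 ρ τ hτ z w hz hw a => ?_⟩
  have hρ0 := hz.nonneg hε.le
  induction a with
  | zero => intro _; exact ⟨1, .one (by simp), by simp⟩
  | succ a ih =>
    intro ha
    have ha' : a * ρ ≤ C := by push_cast at ha; linarith
    obtain ⟨w', hw', e⟩ := ih ha'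
    have hv := h ε hε hε1 _ _ ha' hτ _ _ ((hz.pow a).inv_letterGE hT) hw
    refine ⟨_, (hv.mul hw').mono_radius (le_of_eq (by push_cast; ring)), ?_⟩
    rw [pow_succ', e, pow_succ']
    group

theorem commutator_pow_pow (hT : T⁻¹ = T) [Group.IsNilpotent G] {i j : ℕ} (hi : 1 ≤ i)
    (hj : 1 ≤ j) {C : ℝ} (hC : 0 ≤ C) :
    ∃ C' : ℝ, ∀ ε : ℝ, 0 < ε → ε ≤ 1 → ∀ ρ σ : ℝ, ρ ≤ C → σ ≤ C → ∀ x y : G,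
      WeightBall (LetterGE T i) ε ρ x → WeightBall (LetterGE T j) ε σ y →
      ∀ a b : ℕ, a * ρ ≤ C → b * σ ≤ C → ∃ w, WeightBall (LetterGE T (i + j + 1)) ε C' w ∧
        ⁅x ^ a, y ^ b⁆ = ⁅x, y⁆ ^ (a * b) * w := by
  obtain ⟨C₁, hC₁, h₁⟩ := commutatorBound hT hi hj C hC
  obtain ⟨C₂, hC₂, h₂⟩ := commutator_pow_left hT hi hj hC
  obtain ⟨C₃, hC₃, h₃⟩ := commutator_pow_right hT hi hj hC
  obtain ⟨C₄, hC₄, h₄⟩ := mul_pow_bound hT (show 1 ≤ i + j by omega)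
    (C := C₁ * (C * C) + C₃ * (C * C)) (by positivity)
  refine ⟨C₄ * (C₃ * (C * C)) + C₂ * (C * C),
    fun ε hε hε1 ρ σ hρ hσ x y hx hy a b ha hb => ?_⟩
  have hρ0 := hx.nonneg hε.le
  have hσ0 := hy.nonneg hε.le
  have hz := h₁ ε hε hε1 ρ σ hρ hσ x y hx hy
  -- Expand the left entry first, treating y^b as one bounded word, then the right entry, and raise
  -- the result to the power `a`.
  obtain ⟨w₂, hw₂, e₂⟩ := h₂ ε hε hε1 ρ (b * σ) hρ hb x (y ^ b) hx (hy.pow b) a ha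
  obtain ⟨w₃, hw₃, e₃⟩ := h₃ ε hε hε1 ρ σ hρ hσ x y hx hy b hb
  have hρσ : a * (b * (ρ * σ)) ≤ C * C := by
    calc a * (b * (ρ * σ)) = (a * ρ) * (b * σ) := by ring
      _ ≤ C * C := by gcongr
  have hbσ : b * (ρ * σ) ≤ C * C := by
    calc b * (ρ * σ) = ρ * (b * σ) := by ring
      _ ≤ C * C := by gcongr
  have hτ : C₃ * (b * (ρ * σ)) ≤ C₃ * (C * C) := by gcongr
  have hzab : a * (b * (C₁ * (ρ * σ))) ≤ C₁ * (C * C) := by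
    calc a * (b * (C₁ * (ρ * σ))) = C₁ * (a * (b * (ρ * σ))) := by ring
      _ ≤ C₁ * (C * C) := by gcongr
  obtain ⟨w₄, hw₄, e₄⟩ := h₄ ε hε hε1 _ _ (hτ.trans (le_add_of_nonneg_left (by positivity)))
    _ _ (hz.pow b) hw₃ a (hzab.trans (le_add_of_nonneg_right (by positivity)))
  refine ⟨w₄ * w₂, (hw₄.mul hw₂).mono_radius (add_le_add ?_ ?_), ?_⟩
  · calc C₄ * (a * (C₃ * (b * (ρ * σ)))) = C₄ * (C₃ * (a * (b * (ρ * σ)))) := by ring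
      _ ≤ _ := by gcongr
  · calc C₂ * (a * (ρ * (b * σ))) = C₂ * (a * (b * (ρ * σ))) := by ring
      _ ≤ _ := by gcongr
  · rw [e₂, e₃, e₄, ← pow_mul, mul_comm b, mul_assoc]

end Collection

/-! ### Commutators modulo deeper filtration levels -/

section Filtration

variable {H : Type*} [Group H] {F : ℕ → Subgroup H}

theorem conj_mem_of_filtration (hF : Antitone F)
    (hc : ∀ i j : ℕ, ∀ x ∈ F i, ∀ y ∈ F j, ⁅x, y⁆ ∈ F (i + j)) {i k : ℕ} {x y : H}
    (hx : x ∈ F i) (hy : y ∈ F k) : x * y * x⁻¹ ∈ F k := by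
  have e : x * y * x⁻¹ = ⁅x, y⁆ * y := by simp [commutatorElement_def]
  rw [e]
  exact mul_mem (hF (Nat.le_add_left k i) (hc _ _ _ hx _ hy)) hy

/-- From [xu, yv] = x[u, yv]x⁻¹ · [x, y] · y[x, v]y⁻¹, whose outer factors are one level deeper.
This permits replacing the entries of a commutator by short words. -/
theorem commutator_congr_of_filtration (hF : Antitone F)
    (hc : ∀ i j : ℕ, ∀ x ∈ F i, ∀ y ∈ F j, ⁅x, y⁆ ∈ F (i + j)) {i j : ℕ} {x y u v : H}
    (hx : x ∈ F i) (hy : y ∈ F j) (hu : u ∈ F (i + 1)) (hv : v ∈ F (j + 1)) :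
    ∃ w ∈ F (i + j + 1), ⁅x * u, y * v⁆ = ⁅x, y⁆ * w := by
  have hyv : y * v ∈ F j := mul_mem hy (hF (Nat.le_succ j) hv)
  have h₁ : x * ⁅u, y * v⁆ * x⁻¹ ∈ F (i + j + 1) := by
    have := hc _ _ _ hu _ hyv
    rw [show i + 1 + j = i + j + 1 by omega] at this
    exact conj_mem_of_filtration hF hc hx this
  have h₂ : y * ⁅x, v⁆ * y⁻¹ ∈ F (i + j + 1) :=
    conj_mem_of_filtration hF hc hy (hc _ _ _ hx _ hv)
  have h₃ := conj_mem_of_filtration hF hc (inv_mem (hc _ _ _ hx _ hy)) h₁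
  refine ⟨_, mul_mem h₃ h₂, ?_⟩
  simp only [commutatorElement_def]; group

end Filtration

theorem Set.inv_mem_pow {G : Type*} [Group G] {T : Set G} (hT : T⁻¹ = T) {n : ℕ} {g : G}
    (hg : g ∈ T ^ n) : g⁻¹ ∈ T ^ n := by
  induction n generalizing g with
  | zero => simpa using hg
  | succ n ih =>
    rw [pow_succ] at hg
    obtain ⟨a, ha, b, hb, rfl⟩ := hg
    rw [pow_succ', mul_inv_rev]
    exact Set.mul_mem_mul (by rw [← hT]; simpa using hb) (ih ha)

/-! ### Families of bounded cost at varying scale -/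

section Families

variable {G : Type*} [Group G] {T : Set G} {I : Type*} {N : I → ℕ}

/-- Families `f` of group elements such that `f i` is a product of letters of weight at least `k`
whose total cost at scale `N i` is bounded independently of `i`. -/
def familySubgroup (hT : T⁻¹ = T) (N : I → ℕ) (k : ℕ) : Subgroup (I → G) where
  carrier := {f | ∃ C : ℝ, ∀ i, WeightBall (LetterGE T k) (N i : ℝ)⁻¹ C (f i)}
  one_mem' := ⟨0, fun _ => .one le_rfl⟩
  mul_mem' := by
    rintro f g ⟨C, hf⟩ ⟨D, hg⟩
    exact ⟨C + D, fun i => (hf i).mul (hg i)⟩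
  inv_mem' := by
    rintro f ⟨C, hf⟩
    exact ⟨C, fun i => (hf i).inv_letterGE hT⟩

theorem familySubgroup_antitone (hT : T⁻¹ = T) : Antitone (familySubgroup hT N) := by
  rintro j k hjk f ⟨C, hf⟩
  exact ⟨C, fun i => (hf i).anti hjk⟩

/-- Letters have positive weight. Level 0 serves only to index the filtration by all of ℕ. -/
theorem familySubgroup_zero (hT : T⁻¹ = T) : familySubgroup hT N 0 = familySubgroup hT N 1 := by
  refine le_antisymm ?_ (familySubgroup_antitone hT zero_le_one)
  rintro f ⟨C, hf⟩
  exact ⟨C, fun i => (hf i).mono fun _ _ h => ⟨h.2.pos, h.2⟩⟩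

theorem inv_natCast_pos_le_one {n : ℕ} (hn : 1 ≤ n) : 0 < (n : ℝ)⁻¹ ∧ (n : ℝ)⁻¹ ≤ 1 :=
  ⟨by positivity, inv_le_one_of_one_le₀ (by exact_mod_cast hn)⟩

theorem commutator_mem_familySubgroup (hT : T⁻¹ = T) [Group.IsNilpotent G] (hN : ∀ i, 1 ≤ N i)
    (j k : ℕ) (x : I → G) (hx : x ∈ familySubgroup hT N j) (y : I → G)
    (hy : y ∈ familySubgroup hT N k) : ⁅x, y⁆ ∈ familySubgroup hT N (j + k) := by
  wlog hjk : 1 ≤ j ∧ 1 ≤ k generalizing j k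
  · rcases Nat.eq_zero_or_pos j with rfl | hj
    · rw [familySubgroup_zero] at hx
      rcases Nat.eq_zero_or_pos k with rfl | hk
      · rw [familySubgroup_zero] at hy
        exact familySubgroup_antitone hT (by omega) (this 1 1 hx hy ⟨le_rfl, le_rfl⟩)
      · exact familySubgroup_antitone hT (by omega) (this 1 k hx hy ⟨le_rfl, hk⟩)
    · rcases Nat.eq_zero_or_pos k with rfl | hk
      · rw [familySubgroup_zero] at hy
        exact familySubgroup_antitone hT (by omega) (this j 1 hx hy ⟨hj, le_rfl⟩)
      · exact absurd ⟨hj, hk⟩ hjk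
  obtain ⟨C, hC⟩ := hx
  obtain ⟨D, hD⟩ := hy
  obtain ⟨E, -, hE⟩ := commutatorBound hT hjk.1 hjk.2 (max (max C D) 0) (le_max_right _ _)
  exact ⟨_, fun i => hE _ (inv_natCast_pos_le_one (hN i)).1 (inv_natCast_pos_le_one (hN i)).2 C D
    (by simp) (by simp) _ _ (hC i) (hD i)⟩

theorem eq_one_of_mem_familySubgroup (hT : T⁻¹ = T) {c : ℕ}
    (hc : (⊤ : Subgroup G).lowerCentralSeries c = ⊥) {f : I → G}
    (hf : f ∈ familySubgroup hT N (c + 1)) : f = 1 := by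
  obtain ⟨C, hC⟩ := hf
  funext i
  have := (hC i).mem_lowerCentralSeries
  rwa [Nat.add_sub_cancel, hc, Subgroup.mem_bot] at this

theorem letter_pow_mem_familySubgroup (hT : T⁻¹ = T) {k : ℕ} {t : G} (ht : IsLetter T k t)
    {m : I → ℕ} {C : ℝ} (hm : ∀ i, (m i : ℝ) * (N i : ℝ)⁻¹ ^ k ≤ C) :
    (fun i => t ^ m i) ∈ familySubgroup hT N k :=
  ⟨C, fun i => ((WeightBall.of_letter (P := LetterGE T k) ⟨le_rfl, ht⟩).pow (m i)).mono_radius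
    (hm i)⟩

theorem natCast_mul_inv_pow_le_one {a n n₀ k : ℕ} (hn : 1 ≤ n) (h : n₀ ≤ n) (ha : a ≤ n₀ ^ k) :
    (a : ℝ) * (n : ℝ)⁻¹ ^ k ≤ 1 := by
  have hn' : (0 : ℝ) < n := by exact_mod_cast hn
  rw [inv_pow, ← div_eq_mul_inv, div_le_one (by positivity)]
  exact_mod_cast ha.trans (Nat.pow_le_pow_left h k)

/-- Large powers of letters of weight `k` are short, up to letters of larger weight. -/
theorem exists_short_letter_pow (hT : T⁻¹ = T) (h1 : 1 ∈ T) [Group.IsNilpotent G]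
    (hN : ∀ i, 1 ≤ N i) {k : ℕ} {t : G} (ht : IsLetter T k t) :
    ∃ K : ℕ, ∀ N₀ r : I → ℕ, (∀ i, 1 ≤ N₀ i) → (∀ i, N₀ i ≤ N i) → (∀ i, r i ≤ N₀ i ^ k) →
      ∃ s w : I → G, (∀ i, s i ∈ T ^ (K * N₀ i)) ∧ w ∈ familySubgroup hT N (k + 1) ∧
        (fun i => t ^ r i) = s * w := by
  have hF := familySubgroup_antitone (N := N) hT
  have hc := commutator_mem_familySubgroup hT hN
  induction ht with
  | @base t ht =>
    refine ⟨1, fun N₀ r _ _ hr => ⟨fun i => t ^ r i, 1, fun i => ?_, one_mem _, by simp⟩⟩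
    exact Set.pow_subset_pow_right h1 (by simpa using hr i) (Set.pow_mem_pow ht)
  | @comm i j x y hx hy ihx ihy =>
    obtain ⟨K, hK⟩ := ihx
    obtain ⟨L, hL⟩ := ihy
    obtain ⟨C, hC⟩ := commutator_pow_pow hT hx.pos hy.pos zero_le_one
    have hz : ∀ a b : I → ℕ, (∀ p, (a p : ℝ) * (N p : ℝ)⁻¹ ^ i ≤ 1) →
        (∀ p, (b p : ℝ) * (N p : ℝ)⁻¹ ^ j ≤ 1) → ∃ w ∈ familySubgroup hT N (i + j + 1),
          ⁅(fun p => x ^ a p : I → G), (fun p => y ^ b p : I → G)⁆ =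
            (fun p => ⁅x, y⁆ ^ (a p * b p)) * w := by
      intro a b ha hb
      have : ∀ p, ∃ w, WeightBall (LetterGE T (i + j + 1)) (N p : ℝ)⁻¹ C w ∧
          ⁅x ^ a p, y ^ b p⁆ = ⁅x, y⁆ ^ (a p * b p) * w := by
        intro p
        obtain ⟨h0, h1⟩ := inv_natCast_pos_le_one (hN p)
        exact hC _ h0 h1 _ _ (pow_le_one₀ h0.le h1) (pow_le_one₀ h0.le h1) x y
          (.of_letter ⟨le_rfl, hx⟩) (.of_letter ⟨le_rfl, hy⟩) _ _ (ha p) (hb p)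
      choose w hw e using this
      exact ⟨w, ⟨C, hw⟩, funext e⟩
    -- Write r = ab + d with b = N₀^j, so that [x, y]^r is [x^a, y^b] [x, y^d] up to higher weight.
    -- Each commutator of short words has length at most 2K N₀ + 2L N₀. `K` and `L` do not depend on
    -- `N₀`.
    refine ⟨4 * K + 4 * L, fun N₀ r hN₀ hN₀N hr => ?_⟩
    set a : I → ℕ := fun p => r p / N₀ p ^ j
    set b : I → ℕ := fun p => N₀ p ^ j
    set d : I → ℕ := fun p => r p % N₀ p ^ j
    have hb0 : ∀ p, 0 < N₀ p ^ j := fun p => pow_pos (hN₀ p) j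
    have ha : ∀ p, a p ≤ N₀ p ^ i := fun p =>
      Nat.div_le_of_le_mul (by rw [← pow_add, add_comm]; exact hr p)
    have hd : ∀ p, d p ≤ N₀ p ^ j := fun p => (Nat.mod_lt _ (hb0 p)).le
    have ha' := fun p => natCast_mul_inv_pow_le_one (hN p) (hN₀N p) (ha p)
    have hb' := fun p => natCast_mul_inv_pow_le_one (hN p) (hN₀N p) (le_refl (b p))
    have hd' := fun p => natCast_mul_inv_pow_le_one (hN p) (hN₀N p) (hd p)
    obtain ⟨s₁, u₁, hs₁, hu₁, e₁⟩ := hK N₀ a hN₀ hN₀N ha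
    obtain ⟨s₂, u₂, hs₂, hu₂, e₂⟩ := hL N₀ b hN₀ hN₀N (fun _ => le_rfl)
    obtain ⟨s₃, u₃, hs₃, hu₃, e₃⟩ := hL N₀ d hN₀ hN₀N hd
    obtain ⟨s₄, u₄, hs₄, hu₄, e₄⟩ := hK (fun _ => 1) (fun _ => 1) (fun _ => le_rfl) hN (by simp)
    have h1' : ∀ p, ((1 : ℕ) : ℝ) * (N p : ℝ)⁻¹ ^ i ≤ 1 := fun p =>
      natCast_mul_inv_pow_le_one (hN p) (hN p) (by simp)
    obtain ⟨w₁, hw₁, f₁⟩ := hz a b ha' hb'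
    obtain ⟨w₂, hw₂, f₂⟩ := hz (fun _ => 1) d h1' hd'
    have mem : ∀ {f s u : I → G} {k : ℕ}, f ∈ familySubgroup hT N k →
        u ∈ familySubgroup hT N (k + 1) → f = s * u → s ∈ familySubgroup hT N k := by
      intro f s u k hf hu e
      rw [← mul_inv_eq_iff_eq_mul.2 e]
      exact mul_mem hf (inv_mem (hF (Nat.le_succ k) hu))
    have m₁ := mem (letter_pow_mem_familySubgroup hT hx ha') hu₁ e₁
    have m₂ := mem (letter_pow_mem_familySubgroup hT hy hb') hu₂ e₂
    have m₃ := mem (letter_pow_mem_familySubgroup hT hy hd') hu₃ e₃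
    have m₄ := mem (letter_pow_mem_familySubgroup hT hx h1') hu₄ e₄
    obtain ⟨v₁, hv₁, g₁⟩ := commutator_congr_of_filtration hF hc m₁ m₂ hu₁ hu₂
    obtain ⟨v₂, hv₂, g₂⟩ := commutator_congr_of_filtration hF hc m₄ m₃ hu₄ hu₃
    rw [e₁, e₂, g₁] at f₁
    rw [e₄, e₃, g₂] at f₂
    have q₁ := mul_mem hv₁ (inv_mem hw₁)
    have q₂ := mul_mem hv₂ (inv_mem hw₂)
    have q₃ := conj_mem_of_filtration hF hc (inv_mem (hc _ _ _ m₄ _ m₃)) q₁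
    refine ⟨⁅s₁, s₂⁆ * ⁅s₄, s₃⁆, _, fun p => ?_, mul_mem q₃ q₂, ?_⟩
    · have l₁ := hs₁ p
      have l₂ := hs₂ p
      have l₃ := hs₃ p
      have l₄ : s₄ p ∈ T ^ (K * N₀ p) :=
        Set.pow_subset_pow_right h1 (by gcongr; exact hN₀ p) (hs₄ p)
      have hlen : (⁅s₁, s₂⁆ * ⁅s₄, s₃⁆) p ∈
          T ^ (K * N₀ p + L * N₀ p + K * N₀ p + L * N₀ p +
            (K * N₀ p + L * N₀ p + K * N₀ p + L * N₀ p)) := by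
        simp only [pow_add]
        have l₁' := Set.inv_mem_pow hT l₁
        have l₂' := Set.inv_mem_pow hT l₂
        have l₃' := Set.inv_mem_pow hT l₃
        have l₄' := Set.inv_mem_pow hT l₄
        exact Set.mul_mem_mul
          (Set.mul_mem_mul (Set.mul_mem_mul (Set.mul_mem_mul l₁ l₂) l₁') l₂')
          (Set.mul_mem_mul (Set.mul_mem_mul (Set.mul_mem_mul l₄ l₃) l₄') l₃')
      convert hlen using 2
      ring
    · have e : (fun p => ⁅x, y⁆ ^ r p) =
          (fun p => ⁅x, y⁆ ^ (a p * b p)) * (fun p => ⁅x, y⁆ ^ (1 * d p)) := by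
        funext p
        rw [Pi.mul_apply, ← pow_add, one_mul, mul_comm (a p), Nat.div_add_mod]
      rw [e, eq_mul_inv_of_mul_eq f₁.symm, eq_mul_inv_of_mul_eq f₂.symm]
      group

end Families

/-! ### Thin times short decomposition -/

section Decomposition

variable {G : Type*} [Group G] {T : Set G} {I : Type*} {N : I → ℕ}

/-- A family is thin if it takes boundedly many values on each fibre of `N`. -/
def Thin (N : I → ℕ) (x : I → G) : Prop :=
  ∃ l : ℕ, ∀ n, ∃ V : Finset G, V.card ≤ l ∧ ∀ i, N i = n → x i ∈ V

/-- A family is `M`-short if eventually `s i` has word length at most `N i / M`. -/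
def Short (T : Set G) (N : I → ℕ) (M : ℕ) (s : I → G) : Prop :=
  ∃ n₀ : ℕ, ∀ i, n₀ ≤ N i → ∃ m, s i ∈ T ^ m ∧ M * m ≤ N i

theorem Thin.one : Thin N (1 : I → G) :=
  ⟨1, fun _ => ⟨{1}, by simp, by simp⟩⟩

theorem Thin.mul {x y : I → G} (hx : Thin N x) (hy : Thin N y) : Thin N (x * y) := by
  classical
  obtain ⟨l, hl⟩ := hx
  obtain ⟨l', hl'⟩ := hy
  refine ⟨l * l', fun n => ?_⟩
  obtain ⟨V, hV, hxV⟩ := hl n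
  obtain ⟨V', hV', hyV⟩ := hl' n
  exact ⟨V * V', Finset.card_mul_le.trans (Nat.mul_le_mul hV hV'),
    fun i hi => Finset.mul_mem_mul (hxV i hi) (hyV i hi)⟩

theorem Short.one (M : ℕ) : Short T N M (1 : I → G) :=
  ⟨0, fun _ _ => ⟨0, by simp, by simp⟩⟩

theorem Short.mul {M : ℕ} {s t : I → G} (hs : Short T N (2 * M) s) (ht : Short T N (2 * M) t) :
    Short T N M (s * t) := by
  obtain ⟨n, hn⟩ := hs
  obtain ⟨n', hn'⟩ := ht
  refine ⟨max n n', fun i hi => ?_⟩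
  obtain ⟨m, hm, hm'⟩ := hn i (le_of_max_le_left hi)
  obtain ⟨p, hp, hp'⟩ := hn' i (le_of_max_le_right hi)
  exact ⟨m + p, by rw [pow_add]; exact Set.mul_mem_mul hm hp, by linarith⟩

/-- `f` is the product of a thin family in filtration level `j`, an `M`-short family, and a family
in filtration level `k + 1`. -/
def ThinShort (hT : T⁻¹ = T) (N : I → ℕ) (j k M : ℕ) (f : I → G) : Prop :=
  ∃ x s w : I → G, f = x * s * w ∧ x ∈ familySubgroup hT N j ∧ Thin N x ∧
    s ∈ familySubgroup hT N 1 ∧ Short T N M s ∧ w ∈ familySubgroup hT N (k + 1)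

theorem ThinShort.of_mem (hT : T⁻¹ = T) {j k M : ℕ} {f : I → G}
    (hf : f ∈ familySubgroup hT N (k + 1)) : ThinShort hT N j k M f :=
  ⟨1, 1, f, by simp, one_mem _, .one, one_mem _, .one M, hf⟩

/-- Moving `s` past the second thin factor creates a commutator of level 1 + k, absorbed in the
error; this is why the second thin factor must have level `k`. -/
theorem ThinShort.mul (hT : T⁻¹ = T) [Group.IsNilpotent G] (hN : ∀ i, 1 ≤ N i) {j k M : ℕ}
    (hjk : j ≤ k) {f g : I → G} (hf : ThinShort hT N j k (2 * M) f)
    (hg : ThinShort hT N k k (2 * M) g) : ThinShort hT N j k M (f * g) := by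
  have hF := familySubgroup_antitone (N := N) hT
  have hc := commutator_mem_familySubgroup hT hN
  obtain ⟨x, s, w, rfl, hx, hxt, hs, hss, hw⟩ := hf
  obtain ⟨x', s', w', rfl, hx', hxt', hs', hss', hw'⟩ := hg
  have h₁ : ⁅s⁻¹, x'⁻¹⁆ ∈ familySubgroup hT N (k + 1) := by
    rw [add_comm]; exact hc _ _ _ (inv_mem hs) _ (inv_mem hx')
  have h₂ := conj_mem_of_filtration hF hc (inv_mem hx') hw
  have h₃ := conj_mem_of_filtration hF hc (inv_mem hs') (mul_mem h₁ h₂)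
  refine ⟨x * x', s * s', _, ?_, mul_mem hx (hF hjk hx'), hxt.mul hxt', mul_mem hs hs',
    hss.mul hss', mul_mem h₃ hw'⟩
  simp only [commutatorElement_def]; group

theorem ThinShort.letter_pow (hT : T⁻¹ = T) (h1 : 1 ∈ T) [Group.IsNilpotent G]
    (hN : ∀ i, 1 ≤ N i) {k : ℕ} {t : G} (ht : IsLetter T k t) {m : I → ℕ} {C : ℝ}
    (hm : ∀ i, (m i : ℝ) * (N i : ℝ)⁻¹ ^ k ≤ C) (M : ℕ) :
    ThinShort hT N k k M (fun i => t ^ m i) := by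
  classical
  obtain ⟨K, hK⟩ := exists_short_letter_pow hT h1 hN ht
  -- With n₀ = N/D + 1, this gives n₀ ≤ N always and n₀D ≤ 2N once N ≥ D, hence M·K·n₀ ≤ N. The
  -- modulus n₀^k depends only on N, and the quotients are at most C·D^k, whence thinness.
  set D := 2 * (K * M) + 2 with hD
  have hN₀ : ∀ i, N i / D + 1 ≤ N i := by
    intro i
    have h2 : N i / D ≤ N i / 2 := Nat.div_le_div_left (by omega) (by omega)
    have := hN i
    omega
  have hr : ∀ i, m i % (N i / D + 1) ^ k ≤ (N i / D + 1) ^ k := fun i =>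
    (Nat.mod_lt _ (by positivity)).le
  obtain ⟨s, w, hs, hw, e⟩ := hK (fun i => N i / D + 1) (fun i => m i % (N i / D + 1) ^ k)
    (fun i => Nat.le_add_left _ _) hN₀ hr
  have hx : (fun i => t ^ ((N i / D + 1) ^ k * (m i / (N i / D + 1) ^ k))) ∈
      familySubgroup hT N k := by
    refine letter_pow_mem_familySubgroup hT ht (C := C) fun i => le_trans ?_ (hm i)
    gcongr
    exact Nat.mul_div_le _ _
  have hrm : (fun i => t ^ (m i % (N i / D + 1) ^ k)) ∈ familySubgroup hT N k :=
    letter_pow_mem_familySubgroup hT ht fun i =>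
      natCast_mul_inv_pow_le_one (hN i) (hN₀ i) (hr i)
  refine ⟨_, s, w, ?_, hx, ?_, ?_, ?_, hw⟩
  · rw [mul_assoc, ← e]
    funext i
    rw [Pi.mul_apply, ← pow_add, Nat.div_add_mod]
  · refine ⟨⌊C * D ^ k⌋₊ + 1, fun n => ⟨(Finset.range (⌊C * D ^ k⌋₊ + 1)).image
      fun q => t ^ ((n / D + 1) ^ k * q), Finset.card_image_le.trans (by simp), ?_⟩⟩
    rintro i rfl
    refine Finset.mem_image.2 ⟨_, Finset.mem_range.2 (Nat.lt_succ_of_le (Nat.le_floor ?_)), rfl⟩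
    have hNpos : (0 : ℝ) < (N i : ℝ) := by exact_mod_cast hN i
    have h1 : (m i : ℝ) ≤ C * (N i : ℝ) ^ k := by
      have := hm i
      rwa [inv_pow, ← div_eq_mul_inv, div_le_iff₀ (by positivity)] at this
    have hC : 0 ≤ C := le_trans (by positivity) (hm i)
    have h2 : N i ≤ D * (N i / D + 1) := by
      have := Nat.div_add_mod (N i) D
      have := Nat.mod_lt (N i) (show 0 < D by omega)
      linarith
    refine Nat.cast_div_le.trans ?_
    rw [div_le_iff₀ (by positivity)]
    refine h1.trans ?_
    rw [mul_assoc, Nat.cast_pow, ← mul_pow]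
    gcongr
    exact_mod_cast h2
  · rw [← mul_inv_eq_iff_eq_mul.2 e]
    exact familySubgroup_antitone hT ht.pos
      (mul_mem hrm (inv_mem (familySubgroup_antitone hT (Nat.le_succ k) hw)))
  · refine ⟨D, fun i hi => ⟨_, hs i, ?_⟩⟩
    have h2 : N i / D * D ≤ N i := Nat.div_mul_le_self _ _
    have h3 : (N i / D + 1) * D ≤ 2 * N i := by linarith
    have h4 : (N i / D + 1) * (2 * (K * M)) ≤ (N i / D + 1) * D := by
      gcongr
      omega
    nlinarith

/-- Induction on `Y`: collecting one letter to the left leaves a word in which weight `k` occurs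
only through the remaining letters. -/
theorem thinShort_of_forall_weightBall (hT : T⁻¹ = T) (h1 : 1 ∈ T) [Group.IsNilpotent G]
    (hN : ∀ i, 1 ≤ N i) {k : ℕ} (hk : 1 ≤ k) {Y : Set G} (hfin : Y.Finite)
    (hY : ∀ y ∈ Y, IsLetter T k y) (f : I → G) (C : ℝ)
    (hf : ∀ i, WeightBall (LetterIn T Y k) (N i : ℝ)⁻¹ C (f i)) (M : ℕ) :
    ThinShort hT N k k M f := by
  induction Y, hfin using Set.Finite.induction_on generalizing f C M with
  | empty =>
    refine .of_mem hT ⟨C, fun i => (hf i).mono fun m x h => ?_⟩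
    rcases h with h | h
    · exact h
    · exact absurd h.2 (Set.notMem_empty x)
  | @insert t Y _ _ ih =>
    have ht := hY t (Set.mem_insert t Y)
    have hY' : ∀ y ∈ Y, IsLetter T k y := fun y hy => hY y (Set.mem_insert_of_mem t hy)
    obtain ⟨C', -, h'⟩ := collect_letter hT hk ht hY' (le_max_right C 0)
    have : ∀ i, ∃ (m : ℕ) (g : G), m * (N i : ℝ)⁻¹ ^ k ≤ C ∧
        WeightBall (LetterIn T Y k) (N i : ℝ)⁻¹ (C' * C) g ∧ f i = t ^ m * g := fun i =>
      h' _ (inv_natCast_pos_le_one (hN i)).1 (inv_natCast_pos_le_one (hN i)).2 C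
        (le_max_left _ _) _ (hf i)
    choose m g hm hg e using this
    rw [show f = (fun i => t ^ m i) * g from funext e]
    exact (ThinShort.letter_pow hT h1 hN ht hm _).mul hT hN le_rfl (ih hY' g _ hg _)

theorem thinShort_of_mem (hT : T⁻¹ = T) (h1 : 1 ∈ T) (hfin : T.Finite) [Group.IsNilpotent G]
    (hN : ∀ i, 1 ≤ N i) {k : ℕ} (hk : 1 ≤ k) {f : I → G} (hf : f ∈ familySubgroup hT N k)
    (M : ℕ) : ThinShort hT N k k M f := by
  obtain ⟨C, hC⟩ := hf
  refine thinShort_of_forall_weightBall hT h1 hN hk (IsLetter.finite hfin k) (fun _ h => h) f C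
    (fun i => (hC i).mono fun m x h => ?_) M
  rcases eq_or_lt_of_le h.1 with rfl | hlt
  · exact .inr ⟨rfl, h.2⟩
  · exact .inl ⟨hlt, h.2⟩

/-- The error of level k + 1 is itself decomposed at that level. Each round halves the allowed
length, which is harmless because `M` is arbitrary. -/
theorem thinShort_one (hT : T⁻¹ = T) (h1 : 1 ∈ T) (hfin : T.Finite) [Group.IsNilpotent G]
    (hN : ∀ i, 1 ≤ N i) {f : I → G} (hf : f ∈ familySubgroup hT N 1) (k M : ℕ) :
    ThinShort hT N 1 k M f := by
  induction k generalizing M with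
  | zero => exact .of_mem hT hf
  | succ k ih =>
    obtain ⟨x, s, w, e, hx, hxt, hs, hss, hw⟩ := ih (2 * M)
    rw [e]
    exact ThinShort.mul hT hN (by omega) ⟨x, s, 1, by simp, hx, hxt, hs, hss, one_mem _⟩
      (thinShort_of_mem hT h1 hfin hN (by omega) hw _)

end Decomposition

/-! ### Covering in nilpotent groups -/

/-- Large balls in a nilpotent group are covered by boundedly many translates of balls of
proportional radius. -/
theorem nilpotent_pow_covering {G : Type*} [Group G] [Group.IsNilpotent G] {T : Set G}
    (hT : T⁻¹ = T) (h1 : 1 ∈ T) (hfin : T.Finite) (r M : ℕ) :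
    ∃ l n₀ : ℕ, ∀ n, n₀ ≤ n → ∃ V : Finset G, V.card ≤ l ∧
      ∀ g ∈ T ^ (r * n), ∃ v ∈ V, ∃ m, M * m ≤ n ∧ v⁻¹ * g ∈ T ^ m := by
  obtain ⟨c, hc⟩ := Subgroup.nilpotent_iff_lowerCentralSeries.1 ‹Group.IsNilpotent G›
  -- The tautological family of all pairs (n, g) with g in T^(rn): one decomposition of it is
  -- uniform in both n and g.
  let I := {p : ℕ × G // 1 ≤ p.1 ∧ p.2 ∈ T ^ (r * p.1)}
  let N : I → ℕ := fun p => p.1.1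
  let f : I → G := fun p => p.1.2
  have hN : ∀ i, 1 ≤ N i := fun p => p.2.1
  have hball : ∀ (ε : ℝ) (m : ℕ), ∀ g ∈ T ^ m, WeightBall (LetterGE T 1) ε (m * ε) g := by
    intro ε m
    induction m with
    | zero => rintro g hg; obtain rfl : g = 1 := by simpa using hg
              simpa using WeightBall.one le_rfl
    | succ m ih =>
      rintro g hg
      rw [pow_succ] at hg
      obtain ⟨a, ha, b, hb, rfl⟩ := hg
      refine ((ih a ha).mul (.of_letter (m := 1) ⟨le_rfl, .base hb⟩)).mono_radius (le_of_eq ?_)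
      push_cast; ring
  have hf : f ∈ familySubgroup hT N 1 := by
    refine ⟨r, fun p => (hball _ _ _ p.2.2).mono_radius (le_of_eq ?_)⟩
    have : (p.1.1 : ℝ) ≠ 0 := by
      have := p.2.1
      positivity
    push_cast
    exact mul_inv_cancel_right₀ this _
  obtain ⟨x, s, w, e, -, ⟨l, hl⟩, -, ⟨n₀, hn₀⟩, hw⟩ := thinShort_one hT h1 hfin hN hf c M
  rw [eq_one_of_mem_familySubgroup hT hc hw, mul_one] at e
  refine ⟨l, max n₀ 1, fun n hn => ?_⟩
  obtain ⟨V, hV, hxV⟩ := hl n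
  refine ⟨V, hV, fun g hg => ?_⟩
  let p : I := ⟨(n, g), le_of_max_le_right hn, hg⟩
  obtain ⟨m, hm, hm'⟩ := hn₀ p (le_of_max_le_left hn)
  refine ⟨x p, hxV p rfl, m, hm', ?_⟩
  have : g = x p * s p := congrFun e p
  rwa [this, inv_mul_cancel_left]

/-! ### Passage from a finite index subgroup -/

theorem Set.exists_mem_pow_of_mem_closure {G : Type*} [Group G] {B : Set G} (hB : B⁻¹ = B)
    {g : G} (hg : g ∈ Subgroup.closure B) : ∃ n : ℕ, g ∈ B ^ n := by
  induction hg using Subgroup.closure_induction with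
  | mem x hx => exact ⟨1, by simpa using hx⟩
  | one => exact ⟨0, by simp⟩
  | mul x y _ _ hx hy =>
    obtain ⟨m, hm⟩ := hx
    obtain ⟨n, hn⟩ := hy
    exact ⟨m + n, by rw [pow_add]; exact Set.mul_mem_mul hm hn⟩
  | inv x _ hx =>
    obtain ⟨m, hm⟩ := hx
    exact ⟨m, Set.inv_mem_pow hB hm⟩

theorem Set.Finite.exists_subset_pow {G : Type*} [Group G] {B R : Set G} (hB : B⁻¹ = B)
    (h1 : 1 ∈ B) (hR : R.Finite) (hRB : R ⊆ Subgroup.closure B) : ∃ n : ℕ, R ⊆ B ^ n := by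
  induction R, hR using Set.Finite.induction_on with
  | empty => exact ⟨0, Set.empty_subset _⟩
  | @insert x R _ _ ih =>
    obtain ⟨n, hn⟩ := ih ((Set.subset_insert x R).trans hRB)
    obtain ⟨m, hm⟩ := Set.exists_mem_pow_of_mem_closure hB (hRB (Set.mem_insert x R))
    refine ⟨max m n, Set.insert_subset ?_ (hn.trans ?_)⟩
    · exact Set.pow_subset_pow_right h1 (le_max_left _ _) hm
    · exact Set.pow_subset_pow_right h1 (le_max_right _ _)

/-- Finitely many elements represent all right cosets of a finite index subgroup. -/
theorem Subgroup.exists_finite_right_transversal {G : Type*} [Group G] (N : Subgroup G)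
    [N.FiniteIndex] : ∃ R : Set G, R.Finite ∧ 1 ∈ R ∧ ∀ g, ∃ ρ ∈ R, g * ρ⁻¹ ∈ N := by
  refine ⟨insert 1 (Set.range fun q : G ⧸ N => q.out⁻¹), (Set.finite_range _).insert 1,
    Set.mem_insert _ _, fun g => ⟨_, Set.mem_insert_of_mem _ ⟨(g⁻¹ : G), rfl⟩, ?_⟩⟩
  have : (((g⁻¹ : G) : G ⧸ N).out : G ⧸ N) = (g⁻¹ : G) := Quotient.out_eq _
  rw [inv_inv]
  simpa using QuotientGroup.eq.1 this.symm

/-- Schreier's argument: with T = N ∩ RBR⁻¹, a `B`-word is a `T`-word of the same length times an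
element of `R`, while a `T`-letter is a `B`-word of length 2D + 1. -/
theorem virtuallyNilpotent_pow_covering {G : Type*} [Group G]
    (hG : Group.IsVirtuallyNilpotent G) {B : Set G} (hB : B⁻¹ = B) (h1 : 1 ∈ B)
    (hfin : B.Finite) (htop : Subgroup.closure B = ⊤) (r : ℕ) :
    ∃ l n₀ : ℕ, ∀ n, n₀ ≤ n → ∃ V : Finset G, V.card ≤ l ∧
      ∀ g ∈ B ^ (r * n), ∃ v ∈ V, v⁻¹ * g ∈ B ^ n := by
  classical
  obtain ⟨N, hN, hNi⟩ := hG
  obtain ⟨R, hR, hR1, hRN⟩ := N.exists_finite_right_transversal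
  obtain ⟨D, hD⟩ := hR.exists_subset_pow hB h1 (by simp [htop])
  set T : Set N := Subtype.val ⁻¹' (R * B * R⁻¹) with hTdef
  have hT : T⁻¹ = T := by
    ext x
    simp only [hTdef, Set.mem_inv, Set.mem_preimage, Subgroup.coe_inv]
    rw [← Set.mem_inv, mul_inv_rev, mul_inv_rev, inv_inv, hB, mul_assoc]
  have hT1 : 1 ∈ T := ⟨1, ⟨1, hR1, 1, h1, by simp⟩, 1, by simpa using hR1, by simp⟩
  have hTfin : T.Finite :=
    ((hR.mul hfin).mul hR.inv).preimage Subtype.val_injective.injOn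
  have hTB : ∀ m : ℕ, ∀ t ∈ T ^ m, (t : G) ∈ B ^ ((2 * D + 1) * m) := by
    intro m
    induction m with
    | zero => rintro t ht; obtain rfl : t = 1 := by simpa using ht
              simp
    | succ m ih =>
      rintro t ht
      rw [pow_succ] at ht
      obtain ⟨a, ha, b, ⟨_, ⟨ρ, hρ, x, hx, rfl⟩, ρ', hρ', hb⟩, rfl⟩ := ht
      rw [Subgroup.coe_mul, ← hb, show (2 * D + 1) * (m + 1) = (2 * D + 1) * m + (D + 1 + D) by ring,
        pow_add, pow_add _ (D + 1), pow_add _ D, pow_one]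
      refine Set.mul_mem_mul (ih a ha) (Set.mul_mem_mul (Set.mul_mem_mul (hD hρ) hx) ?_)
      have := Set.inv_mem_pow hB (hD hρ')
      rwa [inv_inv] at this
  have hBT : ∀ m : ℕ, ∀ g ∈ B ^ m, ∃ t ∈ T ^ m, ∃ ρ ∈ R, g = t * ρ := by
    intro m
    induction m with
    | zero => rintro g hg; exact ⟨1, by simp, 1, hR1, by simpa using hg⟩
    | succ m ih =>
      rintro g hg
      rw [pow_succ] at hg
      obtain ⟨a, ha, b, hb, rfl⟩ := hg
      obtain ⟨t, ht, ρ, hρ, rfl⟩ := ih a ha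
      obtain ⟨ρ', hρ', h⟩ := hRN (ρ * b)
      refine ⟨t * ⟨_, h⟩, ?_, ρ', hρ', by simp [mul_assoc]⟩
      rw [pow_succ]
      exact Set.mul_mem_mul ht ⟨_, ⟨ρ, hρ, b, hb, rfl⟩, ρ'⁻¹, by simpa using hρ', rfl⟩
  -- This `M` makes (2D + 1)m at most n/2; the other half of n, with n ≥ 2D, accommodates the
  -- representative in `R`.
  obtain ⟨l, n₀, h⟩ := nilpotent_pow_covering hT hT1 hTfin r (2 * (2 * D + 1))
  refine ⟨l, max n₀ (2 * D), fun n hn => ?_⟩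
  obtain ⟨V, hV, hVT⟩ := h n (le_of_max_le_left hn)
  refine ⟨V.image Subtype.val, Finset.card_image_le.trans hV, fun g hg => ?_⟩
  obtain ⟨t, ht, ρ, hρ, rfl⟩ := hBT _ g hg
  obtain ⟨v, hv, m, hm, hvm⟩ := hVT t ht
  refine ⟨v, Finset.mem_image_of_mem _ hv, ?_⟩
  have hDn := le_of_max_le_right hn
  refine Set.pow_subset_pow_right h1 (show (2 * D + 1) * m + D ≤ n by linarith) ?_
  rw [pow_add, ← mul_assoc]
  exact Set.mul_mem_mul (hTB m _ hvm) (hD hρ)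

theorem Group.IsVirtuallyNilpotent.subgroup {G : Type*} [Group G]
    (hG : Group.IsVirtuallyNilpotent G) (K : Subgroup G) : Group.IsVirtuallyNilpotent K := by
  obtain ⟨N, hN, hNi⟩ := hG
  refine ⟨N.subgroupOf K, ?_, inferInstance⟩
  let f : N.subgroupOf K →* N :=
    ((K.subtype.comp (N.subgroupOf K).subtype).codRestrict N fun x => x.2)
  refine Subgroup.isNilpotent_of_ker_le_center f ?_
  have hf : Function.Injective f := fun x y h =>
    Subtype.ext (Subtype.ext (congrArg (fun z : N => (z : G)) h))
  rw [(MonoidHom.ker_eq_bot_iff f).2 hf]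
  exact bot_le

/-! ### Exact word length and parity -/

theorem Set.exists_mem_pow_of_mem_insert_one_pow {G : Type*} [Group G] {A : Set G} {n : ℕ} {g : G}
    (hg : g ∈ insert 1 A ^ n) : ∃ m ≤ n, g ∈ A ^ m := by
  induction n generalizing g with
  | zero => exact ⟨0, le_rfl, by simpa using hg⟩
  | succ n ih =>
    rw [pow_succ] at hg
    obtain ⟨a, ha, b, hb, rfl⟩ := hg
    obtain ⟨m, hm, ham⟩ := ih ha
    rcases hb with rfl | hb
    · exact ⟨m, by omega, by simpa using ham⟩
    · exact ⟨m + 1, by omega, by rw [pow_succ]; exact Set.mul_mem_mul ham hb⟩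

theorem Set.pow_subset_pow_add_two_mul {G : Type*} [Group G] {A : Set G} (hA : A⁻¹ = A)
    (hne : A.Nonempty) (m i : ℕ) : A ^ m ⊆ A ^ (m + 2 * i) := by
  obtain ⟨a, ha⟩ := hne
  have h1 : (1 : G) ∈ A ^ 2 := by
    rw [pow_two]
    exact ⟨a, ha, a⁻¹, by rw [← hA]; simpa using ha, by simp⟩
  rw [pow_add, pow_mul]
  intro x hx
  exact ⟨x, hx, 1, Set.one_subset.1 ((Set.one_subset.2 (Set.one_mem_one)).trans
    (by simpa using Set.pow_subset_pow_right (n := i) h1 (Nat.zero_le i))), by simp⟩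

/-- Up to a left translation by a fixed element of `A`, words of length at most `n` in a symmetric
set `A` are words of length exactly `n`. -/
theorem Set.mem_pow_or_inv_mul_mem_pow {G : Type*} [Group G] {A : Set G} (hA : A⁻¹ = A) {a : G}
    (ha : a ∈ A) {n : ℕ} {g : G} (hg : g ∈ insert 1 A ^ n) : g ∈ A ^ n ∨ a⁻¹ * g ∈ A ^ n := by
  obtain ⟨m, hm, hgm⟩ := Set.exists_mem_pow_of_mem_insert_one_pow hg
  rcases Nat.even_or_odd' (n - m) with ⟨i, hi | hi⟩
  · left
    have := Set.pow_subset_pow_add_two_mul hA ⟨a, ha⟩ m i hgm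
    rwa [← hi, Nat.add_sub_cancel' hm] at this
  · right
    have h : a⁻¹ * g ∈ A ^ (m + 1) := by
      rw [pow_succ']
      exact Set.mul_mem_mul (by rw [← hA]; simpa using ha) hgm
    have := Set.pow_subset_pow_add_two_mul hA ⟨a, ha⟩ (m + 1) i h
    rwa [show m + 1 + 2 * i = n by omega] at this

/-- Working inside the subgroup generated by `A` makes `B` generating and places the translates
there. Each translate is doubled by {1, a} to correct parity. -/
theorem exists_covering_subset_closure {G : Type*} [Group G]
    (hG : Group.IsVirtuallyNilpotent G) (A : Set G) (hfin : A.Finite) (hne : A.Nonempty)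
    (hsymm : A⁻¹ = A) (r : ℕ) : ∃ l h₀ : ℕ, 1 ≤ l ∧ 1 ≤ h₀ ∧ ∀ h : ℕ, h₀ ≤ h →
      ∃ X : Set G, X ⊆ (Subgroup.closure A : Set G) ∧ X.encard ≤ (l : ℕ∞) ∧
        A ^ (r * h) ⊆ X * A ^ h := by
  classical
  obtain ⟨a, ha⟩ := hne
  set K := Subgroup.closure A with hK
  have hAK : A ⊆ K := Subgroup.subset_closure
  set B : Set K := Subtype.val ⁻¹' (insert 1 A) with hBdef
  have hB : B⁻¹ = B := by
    ext x
    have hx : (x : G)⁻¹ ∈ A ↔ (x : G) ∈ A := by rw [← Set.mem_inv, hsymm]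
    simp [hBdef, hx, Set.mem_insert_iff]
  have hBtop : Subgroup.closure B = ⊤ := by
    rw [eq_top_iff, ← Subgroup.closure_closure_coe_preimage (k := A)]
    exact Subgroup.closure_mono (Set.preimage_mono (Set.subset_insert 1 A))
  have hBA : Subtype.val '' B = insert 1 A := by
    refine Set.image_preimage_eq_of_subset fun x hx => ⟨⟨x, ?_⟩, rfl⟩
    exact Set.insert_subset K.one_mem hAK hx
  have hBpow : ∀ n : ℕ, Subtype.val '' (B ^ n) = insert 1 A ^ n := fun n => by
    rw [← hBA]
    exact Set.image_pow K.subtype B n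
  obtain ⟨l, n₀, h⟩ := virtuallyNilpotent_pow_covering (hG.subgroup K) hB (by simp [hBdef])
    ((hfin.insert 1).preimage Subtype.val_injective.injOn) hBtop r
  refine ⟨max 1 (l * 2), max 1 n₀, le_max_left _ _, le_max_left _ _, fun n hn => ?_⟩
  obtain ⟨V, hV, hVB⟩ := h n (le_of_max_le_right hn)
  have haK : a ∈ K := hAK ha
  refine ⟨Subtype.val '' ((V * {1, ⟨a, haK⟩} : Finset K) : Set K), ?_, ?_, ?_⟩
  · rintro _ ⟨x, -, rfl⟩
    exact x.2
  · refine (Set.encard_image_le _ _).trans ?_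
    rw [Set.encard_coe_eq_coe_finsetCard]
    exact_mod_cast (Finset.card_mul_le.trans (Nat.mul_le_mul hV Finset.card_le_two)).trans
      (le_max_right _ _)
  · intro g hg
    have hg' : g ∈ insert 1 A ^ (r * n) := Set.pow_subset_pow_left (Set.subset_insert 1 A) hg
    rw [← hBpow] at hg'
    obtain ⟨x, hx, rfl⟩ := hg'
    obtain ⟨v, hv, hvx⟩ := hVB x hx
    have hvx' : (v : G)⁻¹ * x ∈ insert 1 A ^ n := by
      rw [← hBpow]
      exact ⟨_, hvx, rfl⟩
    rcases Set.mem_pow_or_inv_mul_mem_pow hsymm ha hvx' with h | h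
    · refine ⟨v * 1, ⟨v * 1, ?_, by simp⟩, _, h, by simp⟩
      exact Finset.mem_coe.2 (Finset.mul_mem_mul hv (by simp))
    · refine ⟨v * a, ⟨v * ⟨a, haK⟩, ?_, rfl⟩, _, h, by simp [mul_assoc]⟩
      exact Finset.mem_coe.2 (Finset.mul_mem_mul hv (by simp))

theorem mainTheorem1 {G : Type*} [Group G] (hG : Group.IsVirtuallyNilpotent G)
    (A : Set G) (hfin : A.Finite) (hne : A.Nonempty) (hsymm : A⁻¹ = A) :
    (∀ r : ℕ, 1 ≤ r → ∃ l h₀ : ℕ, 1 ≤ l ∧ 1 ≤ h₀ ∧ ∀ h : ℕ, h₀ ≤ h →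
      ∃ X : Set G, X ⊆ (Subgroup.closure A : Set G) ∧ X.encard ≤ (l : ℕ∞) ∧
        A ^ (r * h) ⊆ X * A ^ h) ∧
    IsAsymptoticApproxGroup A := by
  refine ⟨fun r _ => exists_covering_subset_closure hG A hfin hne hsymm r, hne, fun r hr => ?_⟩
  obtain ⟨l, h₀, hl, hh₀, h⟩ := exists_covering_subset_closure hG A hfin hne hsymm r
  refine ⟨l, hr, hl, hne, h₀, hh₀, fun n hn => ?_⟩
  obtain ⟨X, -, hX, hAX⟩ := h n hn
  exact ⟨X, hX, hAX⟩
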